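/- Let $n\ge 1$, let $V_1,\dots,V_m\in\mathbb{C}^{n\times n}$, and let $\Psi$ be the completely positive map $\Psi(X)=\sum_{i=1}^m V_iXV_i^*$ on the real space of Hermitian $n\times n$ matrices. Write $\preceq$ for the Loewner order. A face of the cone of positive semidefinite matrices is a closed convex cone $\mathcal F$ strictly contained in it such that $P\in\mathcal F$ and $0\preceq Q\preceq P$ imply $Q\in\mathcal F$. The map $\Psi$ is irreducible if it leaves no face other than $\{0\}$ invariant; it is strictly positive if $\Psi(X)$ is positive definite for every nonzero positive semidefinite $X$; and it is primitive if $\Psi^p$ is strictly positive for some integer $p\ge 1$. For $q\ge 1$ let $\mathcal S_q(V_1,\dots,V_m)$ be the complex linear span of all products $V_{i_q}\cdots V_{i_1}$ with $i_1,\dots,i_q\in\{1,\dots,m\}$, and let $r=\dim_{\mathbb C}\mathcal S_1(V_1,\dots,V_m)$ be the number of linearly independent matrices among the $V_i$ (so $r=m$ when $V_1,\dots,V_m$ are linearly independent). Theorem. Assume that $\Psi$ is irreducible. Then $\Psi$ is primitive if and only if there is an integer $q$ with $1\le q\le (n^2-r+1)\,n^2$ such that $\mathcal S_q(V_1,\dots,V_m)=\mathbb{C}^{n\times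 n}$. -/

import Mathlib

open scoped ComplexOrder

/-- The real vector space of Hermitian `n × n` complex matrices. -/
abbrev Herm (n : ℕ) : Type := selfAdjoint (Matrix (Fin n) (Fin n) ℂ)

/-- The cone of positive semidefinite Hermitian matrices. -/
def psdCone (n : ℕ) : PointedCone ℝ (Herm n) where
  carrier := {X | (X : Matrix (Fin n) (Fin n) ℂ).PosSemidef}
  add_mem' := fun hX hY => by
    simpa using Matrix.PosSemidef.add hX hY
  zero_mem' := by
    simpa using (Matrix.PosSemidef.zero : (0 : Matrix (Fin n) (Fin n) ℂ).PosSemidef)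
  smul_mem' := fun c X hX => by
    have h : ((c • X : Herm n) : Matrix (Fin n) (Fin n) ℂ)
        = (c : ℝ) • (X : Matrix (Fin n) (Fin n) ℂ) := rfl
    show ((c • X : Herm n) : Matrix (Fin n) (Fin n) ℂ).PosSemidef
    rw [h]
    exact Matrix.PosSemidef.smul hX c.2

/-- The completely positive map `X ↦ ∑ i, V i * X * (V i)ᴴ` on Hermitian matrices. -/
noncomputable def cpMap {n m : ℕ} (V : Fin m → Matrix (Fin n) (Fin n) ℂ) :
    Herm n →ₗ[ℝ] Herm n where
  toFun X := ⟨∑ i, V i * (X : Matrix (Fin n) (Fin n) ℂ) * (V i).conjTranspose, by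
    have hX : (X : Matrix (Fin n) (Fin n) ℂ).conjTranspose = X := X.2
    rw [selfAdjoint.mem_iff, Matrix.star_eq_conjTranspose, Matrix.conjTranspose_sum]
    simp [Matrix.conjTranspose_mul, hX, Matrix.mul_assoc]⟩
  map_add' X Y := by
    apply Subtype.ext
    simp [Matrix.mul_add, Matrix.add_mul, Finset.sum_add_distrib]
  map_smul' c X := by
    apply Subtype.ext
    simp [Finset.smul_sum]

/-- A face of the cone of positive semidefinite matrices: a closed convex cone strictly contained
in it which, together with `P`, contains every positive semidefinite `Q ⪯ P`. -/
structure IsPsdFace {n : ℕ} (F : PointedCone ℝ (Herm n)) : Prop where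
  isClosed : IsClosed (F : Set (Herm n))
  lt_psdCone : F < psdCone n
  mem_of_le : ∀ P ∈ F, ∀ Q ∈ psdCone n, P - Q ∈ psdCone n → Q ∈ F

/-- `Φ` leaves no face of the positive semidefinite cone invariant, other than the trivial
face `{0}` (which every linear map leaves invariant). -/
def IsIrreducibleMap {n : ℕ} (Φ : Herm n →ₗ[ℝ] Herm n) : Prop :=
  ¬ ∃ F : PointedCone ℝ (Herm n), IsPsdFace F ∧ F ≠ ⊥ ∧ ∀ X ∈ F, Φ X ∈ F

/-- `Φ` sends every nonzero positive semidefinite matrix to a positive definite one. -/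
def IsStrictlyPositiveMap {n : ℕ} (Φ : Herm n →ₗ[ℝ] Herm n) : Prop :=
  ∀ X ∈ psdCone n, X ≠ 0 → (Φ X : Matrix (Fin n) (Fin n) ℂ).PosDef

/-- Some positive power (iterate) of `Φ` is strictly positive. -/
def IsPrimitiveMap {n : ℕ} (Φ : Herm n →ₗ[ℝ] Herm n) : Prop :=
  ∃ p : ℕ, 0 < p ∧ IsStrictlyPositiveMap (Φ ^ p)

/-- The complex linear span of all products of exactly `k` of the matrices `V i`,
repetitions allowed. -/
def productSpan {n m : ℕ} (V : Fin m → Matrix (Fin n) (Fin n) ℂ) (k : ℕ) :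
    Submodule ℂ (Matrix (Fin n) (Fin n) ℂ) :=
  Submodule.span ℂ (Set.range fun i : Fin k → Fin m => (List.ofFn fun j => V (i j)).prod)

/-!
The proof is linear algebra over the powers of a single subspace. Let `S` be the span of the `V i`
in the matrix algebra; the span of the `k`-fold products is then the power `S ^ k` of submodules
(`productSpan_eq_pow`), and for positive semidefinite `X` the vector `y` is killed by `Ψ ^ p X`
exactly when `X W* y = 0` for all `W ∈ S ^ p` (`cpMap_pow_mulVec_eq_zero_iff`). If `S ^ q` is the
full algebra, this forces `X = 0` or `y = 0`, so `Ψ ^ q` is strictly positive.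

Conversely, if `Ψ ^ p` is strictly positive, then `B = S ^ p` satisfies `B x = ℂⁿ` for every
`x ≠ 0`. Consider a nonzero matrix `T` of least rank in the powers of `B`. If its rank were at least
two, the matrices `T W T` with `W ∈ B` would include two whose pencil, regarded as maps
`ℂⁿ / ker T → range T`, has a nonzero singular member, of smaller rank than `T`
(`exists_mul_mul_rank_lt`). So `T` has rank one, and `B T B` is everything
(`exists_pow_eq_top_of_transitive`). This gives *some* full power `S ^ J`.

The bound on the exponent comes from three dimension counts, each an instance of
`min_add_le_of_stall`: a chain of subspaces that, once it stalls, stalls forever has to grow by a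
dimension at each step until it is full.
* The sums `S + S² + ⋯ + S^k` are full for `k = n² - dim S + 1`, so one of the first
  `n² - dim S + 1` powers contains a matrix of nonzero trace, hence a matrix `A` that is not
  nilpotent (`exists_not_isNilpotent_mem_pow`). Let `B` now be that power, choose `s` such that the
  ranks of the powers of `A` stop dropping at `s`, and let `R` be the range of `A ^ s`, of
  dimension `ρ ≤ n - s`, on which `A` is invertible.
* The dimension of `A ^ s * B ^ k` does not decrease with `k`, since multiplication by `A` is
  injective there, so `A ^ s * B ^ (ρ n)` is the whole right ideal of `A ^ s`
  (`span_singleton_mul_pow_eq`).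
* The spaces `B ^ j R` increase with `j`, since `A R = R`, so `B ^ (n - ρ) R = ℂⁿ`
  (`map₂_mulVec_pow_eq_top`).

Together, `B ^ (n - ρ) * A ^ s * B ^ (ρ n)` is the full algebra, and the total exponent
`(n - ρ) + s + ρ n ≤ 2 (n - ρ) + ρ n` is at most `n²` (`pow_card_sq_eq_top`).
-/

/-! ### Growth of powers of a subspace of the matrix algebra -/

open Matrix in
/-- If every rank-one matrix `u wᵀ` lies in `M`, then `M` is everything. -/
theorem eq_top_of_forall_vecMulVec_mem {K ι : Type*} [Field K] [Fintype ι] [DecidableEq ι]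
    {M : Submodule K (Matrix ι ι K)} (h : ∀ u w : ι → K, vecMulVec u w ∈ M) : M = ⊤ := by
  refine eq_top_iff.2 fun X _ => ?_
  rw [matrix_eq_sum_single X]
  refine Submodule.sum_mem _ fun i _ => Submodule.sum_mem _ fun j _ => ?_
  have := M.smul_mem (X i j) (h (Pi.single i 1) (Pi.single j 1))
  rwa [← single_eq_single_vecMulVec_single, smul_single, smul_eq_mul, mul_one] at this

theorem pow_eq_top_of_le {K A : Type*} [Field K] [Ring A] [Algebra K A] {B : Submodule K A}
    {J : ℕ} (hJ0 : 0 < J) (hJ : B ^ J = ⊤) {k : ℕ} (hk : J ≤ k) : B ^ k = ⊤ := by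
  have hB : B * ⊤ = ⊤ := by
    obtain ⟨j, rfl⟩ : ∃ j, J = j + 1 := ⟨J - 1, by omega⟩
    refine eq_top_iff.2 ?_
    calc (⊤ : Submodule K A) = B * B ^ j := by rw [← pow_succ', hJ]
      _ ≤ B * ⊤ := mul_le_mul' le_rfl le_top
  induction k, hk using Nat.le_induction with
  | base => exact hJ
  | succ k _ ih => rw [pow_succ', ih, hB]

/-- A monotone sequence of naturals that is constant from its first repetition on, and that
reaches `N` somewhere, increases by at least one at every step until it has reached `N`. -/
theorem min_add_le_of_stall {d : ℕ → ℕ} {N J : ℕ} (hmono : ∀ k, d k ≤ d (k + 1))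
    (hstall : ∀ k, d (k + 1) = d k → d (k + 2) = d (k + 1)) (hJ : N ≤ d J)
    (k : ℕ) : min (d 0 + k) N ≤ d k := by
  have hmon : Monotone d := monotone_nat_of_le_succ hmono
  induction k with
  | zero => simp
  | succ k ih =>
    rcases (hmono k).eq_or_lt with h | h
    · have hconst : ∀ j, d (k + j + 1) = d (k + j) := by
        intro j
        induction j with
        | zero => exact h.symm
        | succ j ihj => exact hstall _ ihj
      have hall : ∀ j, d (k + j) = d k := by
        intro j
        induction j with
        | zero => rfl
        | succ j ihj => rw [← add_assoc, hconst, ihj]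
      have h1 := hmon (show J ≤ k + J by omega)
      have h2 := hall J
      omega
    · omega

/-! ### The exponent bound -/

open Matrix in
/-- Left multiplication by `A` preserves the dimension of a space of matrices whose columns lie in
the range of `A ^ s`, once the ranks of the powers of `A` no longer drop at `s`. -/
theorem finrank_span_singleton_mul_eq {K ι : Type*} [Field K] [Fintype ι] [DecidableEq ι]
    {A : Matrix ι ι K} {s : ℕ} (hs : (A ^ (s + 1)).rank = (A ^ s).rank)
    {Y : Submodule K (Matrix ι ι K)} (hY : Y ≤ (K ∙ (A ^ s)) * ⊤) :
    Module.finrank K ↥((K ∙ A) * Y) = Module.finrank K Y := by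
  have hker : LinearMap.ker (A ^ s).mulVecLin = LinearMap.ker (A ^ (s + 1)).mulVecLin := by
    refine Submodule.eq_of_le_of_finrank_le (fun x hx => ?_) ?_
    · simp only [LinearMap.mem_ker, Matrix.mulVecLin_apply] at hx ⊢
      rw [pow_succ', ← Matrix.mulVec_mulVec, hx, Matrix.mulVec_zero]
    · have h1 := LinearMap.finrank_range_add_finrank_ker (A ^ s).mulVecLin
      have h2 := LinearMap.finrank_range_add_finrank_ker (A ^ (s + 1)).mulVecLin
      unfold Matrix.rank at hs
      omega
  have hinj : Function.Injective ((LinearMap.mulLeft K A).domRestrict Y) := by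
    rw [← LinearMap.ker_eq_bot, LinearMap.ker_eq_bot']
    rintro ⟨Z, hZ⟩ h0
    obtain ⟨X, -, rfl⟩ := Submodule.mem_span_singleton_mul.1 (hY hZ)
    have h0 : A * (A ^ s * X) = 0 := h0
    ext1
    refine Matrix.ext_of_mulVec_single fun j => ?_
    have hx : X *ᵥ Pi.single j 1 ∈ LinearMap.ker (A ^ (s + 1)).mulVecLin := by
      rw [LinearMap.mem_ker, Matrix.mulVecLin_apply, Matrix.mulVec_mulVec, pow_succ', mul_assoc, h0,
        Matrix.zero_mulVec]
    rw [← hker, LinearMap.mem_ker, Matrix.mulVecLin_apply, Matrix.mulVec_mulVec] at hx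
    exact hx.trans (Matrix.zero_mulVec _).symm
  rw [← LinearMap.finrank_range_of_inj hinj, LinearMap.range_domRestrict]
  have : (K ∙ A) * Y = Submodule.map (LinearMap.mulLeft K A) Y := by
    ext X
    simp [Submodule.mem_span_singleton_mul]
  rw [this]

open Matrix in
theorem finrank_span_singleton_mul_top_le {K ι : Type*} [Field K] [Fintype ι] [DecidableEq ι]
    (A : Matrix ι ι K) :
    Module.finrank K ↥((K ∙ A) * (⊤ : Submodule K (Matrix ι ι K))) ≤ A.rank * Fintype.card ι := by
  -- A matrix `A * X` is determined by its columns, which lie in the range of `A`.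
  let f : ↥((K ∙ A) * (⊤ : Submodule K (Matrix ι ι K))) →ₗ[K] ι → LinearMap.range A.mulVecLin :=
    { toFun := fun X j => ⟨X.1 *ᵥ Pi.single j 1, by
        obtain ⟨Z, -, hZ⟩ := Submodule.mem_span_singleton_mul.1 X.2
        exact ⟨Z *ᵥ Pi.single j 1, by rw [Matrix.mulVecLin_apply, Matrix.mulVec_mulVec, hZ]⟩⟩
      map_add' := fun X Y => by
        ext j : 2
        exact Matrix.add_mulVec _ _ _
      map_smul' := fun c X => by
        ext j : 2
        exact Matrix.smul_mulVec _ _ _ }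
  have hf : Function.Injective f := fun X Y h => by
    ext1
    exact Matrix.ext_of_mulVec_single fun j => congrArg Subtype.val (congrFun h j)
  calc _ ≤ Module.finrank K (ι → LinearMap.range A.mulVecLin) :=
        LinearMap.finrank_le_finrank_of_injective hf
    _ = _ := by simp [Module.finrank_pi_fintype, Matrix.rank, mul_comm]

/-- The ranks of the powers of a matrix stop dropping early: at an exponent `s` that is at most the
corank of `A ^ s`. -/
theorem exists_rank_pow_succ_eq {K ι : Type*} [Field K] [Fintype ι] [DecidableEq ι]
    (A : Matrix ι ι K) :
    ∃ s, (A ^ (s + 1)).rank = (A ^ s).rank ∧ s + (A ^ s).rank ≤ Fintype.card ι := by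
  by_contra! h
  have key : ∀ s, s + (A ^ s).rank ≤ Fintype.card ι := by
    intro s
    induction s with
    | zero => simp
    | succ s ih =>
      have h1 : (A ^ (s + 1)).rank ≤ (A ^ s).rank := by
        rw [pow_succ]
        exact Matrix.rank_mul_le_left _ _
      have h2 : (A ^ (s + 1)).rank ≠ (A ^ s).rank := fun h2 => absurd ih (h s h2).not_ge
      omega
  have := key (Fintype.card ι + 1)
  omega

open Matrix in
theorem map₂_mulVec_mul {K ι : Type*} [Field K] [Fintype ι] [DecidableEq ι]
    (B C : Submodule K (Matrix ι ι K)) (R : Submodule K (ι → K)) :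
    Submodule.map₂ (mulVecBilin K K) (B * C) R =
      Submodule.map₂ (mulVecBilin K K) B (Submodule.map₂ (mulVecBilin K K) C R) := by
  apply le_antisymm
  · refine Submodule.map₂_le.2 fun X hX r hr => ?_
    induction hX using Submodule.mul_induction_on' with
    | mem_mul_mem b hb c hc =>
      rw [mulVecBilin_apply, ← mulVec_mulVec]
      exact Submodule.apply_mem_map₂ _ hb (Submodule.apply_mem_map₂ _ hc hr)
    | add x _ y _ hx hy =>
      rw [map_add, LinearMap.add_apply]
      exact add_mem hx hy
  · refine Submodule.map₂_le.2 fun b hb v hv => ?_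
    have : Submodule.map₂ (mulVecBilin K K) C R ≤
        (Submodule.map₂ (mulVecBilin K K) (B * C) R).comap (mulVecBilin K K b) := by
      refine Submodule.map₂_le.2 fun c hc r hr => ?_
      rw [Submodule.mem_comap, mulVecBilin_apply, mulVecBilin_apply, mulVec_mulVec]
      exact Submodule.apply_mem_map₂ (mulVecBilin K K) (Submodule.mul_mem_mul hb hc) hr
    exact this hv

/-- If `R` is nonzero, contained in `B R`, and `B ^ J` is everything, then the spaces `B ^ j R`
increase and fill the whole space after as many steps as the codimension of `R`. -/
theorem map₂_mulVec_pow_eq_top {K ι : Type*} [Field K] [Fintype ι] [DecidableEq ι]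
    {B : Submodule K (Matrix ι ι K)} {J : ℕ} (hJ : B ^ J = ⊤) {R : Submodule K (ι → K)}
    (hR0 : R ≠ ⊥) (hR : R ≤ Submodule.map₂ (Matrix.mulVecBilin K K) B R) :
    Submodule.map₂ (Matrix.mulVecBilin K K) (B ^ (Fintype.card ι - Module.finrank K R)) R = ⊤ := by
  set U : ℕ → Submodule K (ι → K) := fun j => Submodule.map₂ (Matrix.mulVecBilin K K) (B ^ j) R
    with hU
  have hsucc : ∀ j, U (j + 1) = Submodule.map₂ (Matrix.mulVecBilin K K) B (U j) := fun j => by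
    simp only [hU, pow_succ', map₂_mulVec_mul]
  -- At `j = 0` the acting space is spanned by the identity matrix.
  have hU0 : R ≤ U 0 := fun r hr => by
    have := Submodule.apply_mem_map₂ (Matrix.mulVecBilin K K)
      (Submodule.one_le.1 le_rfl : (1 : Matrix ι ι K) ∈ (1 : Submodule K (Matrix ι ι K))) hr
    simpa [hU] using this
  have hmono : ∀ j, U j ≤ U (j + 1) := fun j => by
    simp only [hU, pow_succ, map₂_mulVec_mul]
    exact Submodule.map₂_le_map₂_right hR
  have hUJ : U J = ⊤ := by
    obtain ⟨r, hr, hr0⟩ := Submodule.exists_mem_ne_zero_of_ne_bot hR0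
    obtain ⟨i, hi⟩ := Function.ne_iff.1 hr0
    refine eq_top_iff.2 fun v _ => ?_
    have := Submodule.apply_mem_map₂ (Matrix.mulVecBilin K K)
      (show Matrix.vecMulVec v (Pi.single i (r i)⁻¹) ∈ B ^ J from hJ ▸ trivial) hr
    have hi : r i ≠ 0 := hi
    simpa [hU, Matrix.vecMulVec_mulVec, hi] using this
  have hcount := min_add_le_of_stall (d := fun j => Module.finrank K (U j))
    (N := Fintype.card ι) (J := J) (fun k => Submodule.finrank_mono (hmono k))
    (fun k hk => by
      have h1 := Submodule.eq_of_le_of_finrank_le (hmono k) hk.le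
      have h2 : U (k + 1 + 1) = U (k + 1) := by
        rw [hsucc (k + 1), ← h1, ← hsucc k, h1]
      change Module.finrank K (U (k + 1 + 1)) = Module.finrank K (U (k + 1))
      rw [h2])
    (by rw [hUJ, finrank_top, Module.finrank_fintype_fun_eq_card])
    (Fintype.card ι - Module.finrank K R)
  have h0 : Module.finrank K R ≤ Module.finrank K (U 0) := Submodule.finrank_mono hU0
  change U (Fintype.card ι - Module.finrank K R) = ⊤
  refine Submodule.eq_top_of_finrank_eq (le_antisymm (Submodule.finrank_le _) ?_)
  rw [Module.finrank_fintype_fun_eq_card]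
  have : Module.finrank K R ≤ Fintype.card ι := (Submodule.finrank_le R).trans (by simp)
  omega

/-- If the powers of `B` eventually fill the matrix algebra, then `A ^ s * B ^ k` fills the right
ideal of `A ^ s` as soon as `k` is the bound on its dimension. -/
theorem span_singleton_mul_pow_eq {K ι : Type*} [Field K] [Fintype ι] [DecidableEq ι]
    {B : Submodule K (Matrix ι ι K)} {J : ℕ} (hJ : B ^ J = ⊤) {A : Matrix ι ι K} (hA : A ∈ B)
    {s : ℕ} (hs : (A ^ (s + 1)).rank = (A ^ s).rank) :
    (K ∙ (A ^ s)) * B ^ ((A ^ s).rank * Fintype.card ι) = (K ∙ (A ^ s)) * ⊤ := by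
  set Y : ℕ → Submodule K (Matrix ι ι K) := fun k => (K ∙ (A ^ s)) * B ^ k with hY
  have hcomm : (K ∙ A) * (K ∙ (A ^ s)) = (K ∙ (A ^ s)) * (K ∙ A) := by
    rw [Submodule.span_mul_span, Submodule.span_mul_span, Set.singleton_mul_singleton,
      Set.singleton_mul_singleton, ← pow_succ, ← pow_succ']
  have hYtop : ∀ k, Y k ≤ (K ∙ (A ^ s)) * ⊤ := fun k => mul_le_mul' le_rfl le_top
  have hAY : ∀ k, (K ∙ A) * Y k ≤ Y (k + 1) := fun k => by
    simp only [hY]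
    rw [← mul_assoc, hcomm, mul_assoc, pow_succ']
    exact mul_le_mul' le_rfl (mul_le_mul' ((Submodule.span_singleton_le_iff_mem _ _).2 hA) le_rfl)
  have hfin : ∀ k, Module.finrank K ↥((K ∙ A) * Y k) = Module.finrank K (Y k) := fun k =>
    finrank_span_singleton_mul_eq hs (hYtop k)
  have hsucc : ∀ k, Y (k + 1) = Y k * B := fun k => by simp only [hY, pow_succ, mul_assoc]
  have hcount := min_add_le_of_stall (d := fun k => Module.finrank K (Y k))
    (N := Module.finrank K ↥((K ∙ (A ^ s)) * (⊤ : Submodule K (Matrix ι ι K)))) (J := J)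
    (fun k => (hfin k).symm.le.trans (Submodule.finrank_mono (hAY k)))
    (fun k hk => by
      have h1 : (K ∙ A) * Y k = Y (k + 1) :=
        Submodule.eq_of_le_of_finrank_le (hAY k) (by rw [hfin k]; exact hk.le)
      have h2 : (K ∙ A) * Y (k + 1) = Y (k + 2) := by
        rw [hsucc (k + 1), ← h1, mul_assoc, ← hsucc k, h1]
      show Module.finrank K (Y (k + 2)) = _
      rw [← h2, hfin])
    (by rw [show Y J = (K ∙ (A ^ s)) * ⊤ by simp only [hY, hJ]])
    ((A ^ s).rank * Fintype.card ι)
  refine Submodule.eq_of_le_of_finrank_le (hYtop _) ?_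
  change _ ≤ Module.finrank K (Y ((A ^ s).rank * Fintype.card ι))
  have := finrank_span_singleton_mul_top_le (A ^ s)
  omega

open Matrix in
/-- If `B` contains a matrix `A` that is not nilpotent and some power of `B` is the full matrix
algebra, then so is `B ^ n²`. -/
theorem pow_card_sq_eq_top {K ι : Type*} [Field K] [Fintype ι] [DecidableEq ι]
    {B : Submodule K (Matrix ι ι K)} {J : ℕ} (hJ : B ^ J = ⊤) {A : Matrix ι ι K}
    (hA : A ∈ B) (hnil : ¬ IsNilpotent A) : B ^ Fintype.card ι ^ 2 = ⊤ := by
  obtain ⟨s, hs, hsn⟩ := exists_rank_pow_succ_eq A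
  set ρ := (A ^ s).rank
  set n := Fintype.card ι
  set R := LinearMap.range (A ^ s).mulVecLin with hRdef
  have hRρ : Module.finrank K R = ρ := rfl
  have hR0 : R ≠ ⊥ := fun h => hnil ⟨s, by
    rw [hRdef, LinearMap.range_eq_bot] at h
    exact Matrix.ext_of_mulVec_single fun i => (LinearMap.congr_fun h (Pi.single i 1)).trans
      (zero_mulVec _).symm⟩
  have hρ1 : 1 ≤ ρ := by
    rw [← hRρ]
    exact Submodule.one_le_finrank_iff.2 hR0
  have hR : R ≤ Submodule.map₂ (mulVecBilin K K) B R := by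
    have hle : LinearMap.range (A ^ (s + 1)).mulVecLin ≤ R := by
      rintro _ ⟨x, rfl⟩
      exact ⟨A *ᵥ x, by simp [pow_succ]⟩
    have heq : LinearMap.range (A ^ (s + 1)).mulVecLin = R :=
      Submodule.eq_of_le_of_finrank_le hle hs.symm.le
    rw [← heq]
    rintro _ ⟨x, rfl⟩
    rw [heq, mulVecLin_apply, pow_succ', ← mulVec_mulVec]
    exact Submodule.apply_mem_map₂ (mulVecBilin K K) hA
      (show A ^ s *ᵥ x ∈ R from ⟨x, rfl⟩)
  have hU := map₂_mulVec_pow_eq_top hJ hR0 hR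
  rw [hRρ] at hU
  have hfull : B ^ (n - ρ) * ((K ∙ (A ^ s)) * ⊤) = ⊤ := by
    refine eq_top_of_forall_vecMulVec_mem fun u w => ?_
    have hle : Submodule.map₂ (mulVecBilin K K) (B ^ (n - ρ)) R ≤
        (B ^ (n - ρ) * ((K ∙ (A ^ s)) * ⊤)).comap ((vecMulVecBilin K K).flip w) := by
      refine Submodule.map₂_le.2 fun b hb r hr => ?_
      obtain ⟨x, rfl⟩ := hr
      simp only [Submodule.mem_comap, LinearMap.flip_apply, mulVecBilin_apply]
      change vecMulVec (b *ᵥ (A ^ s *ᵥ x)) w ∈ _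
      rw [← mul_vecMulVec, ← mul_vecMulVec]
      exact Submodule.mul_mem_mul hb
        (Submodule.mul_mem_mul (Submodule.mem_span_singleton_self _) trivial)
    exact hle (hU ▸ trivial : u ∈ _)
  have hexp : B ^ ((n - ρ) + (s + ρ * n)) = ⊤ := by
    refine eq_top_iff.2 ?_
    rw [← hfull, ← span_singleton_mul_pow_eq hJ hA hs, pow_add, pow_add]
    exact mul_le_mul' le_rfl (mul_le_mul' ((Submodule.span_singleton_le_iff_mem _ _).2
      (Submodule.pow_mem_pow B hA s)) le_rfl)
  -- With `t = n - ρ ≥ s`, the claim follows from `2 t + ρ n ≤ n ^ 2`, that is, `2 t ≤ n t`. If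
  -- `t = 0` this holds even for `n = 1`; otherwise `n ≥ ρ + 1 ≥ 2`.
  have hle : (n - ρ) + (s + ρ * n) ≤ n ^ 2 := by
    obtain ⟨t, ht⟩ : ∃ t, n = ρ + t := ⟨n - ρ, by omega⟩
    rw [ht] at hsn ⊢
    rcases Nat.eq_zero_or_pos t with rfl | ht0
    · rw [show s = 0 by omega]
      simp [sq]
    · have : s ≤ t := by omega
      have : 2 * t ≤ (ρ + t) * t := Nat.mul_le_mul_right _ (by omega)
      rw [Nat.add_sub_cancel_left]
      nlinarith
  refine pow_eq_top_of_le ?_ hexp hle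
  have : 0 < ρ * n := Nat.mul_pos hρ1 (by omega)
  omega

open Matrix in
/-- If some power of `S` is the full matrix algebra, one of the first `n² - dim S + 1` powers
contains a matrix that is not nilpotent: the sums `S + S² + ⋯ + S^k` gain a dimension at each step
until they contain a matrix of trace one. -/
theorem exists_not_isNilpotent_mem_pow {K ι : Type*} [Field K] [Fintype ι] [DecidableEq ι]
    [Nonempty ι] {S : Submodule K (Matrix ι ι K)} {J : ℕ} (hJ0 : 0 < J) (hJ : S ^ J = ⊤) :
    ∃ k, 1 ≤ k ∧ k ≤ Fintype.card ι ^ 2 - Module.finrank K S + 1 ∧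
      ∃ A ∈ S ^ k, ¬ IsNilpotent A := by
  set T : ℕ → Submodule K (Matrix ι ι K) := fun k => ∑ i ∈ Finset.range (k + 1), S ^ (i + 1)
    with hT
  have hsucc : ∀ k, T (k + 1) = S * T k + S := fun k => by
    simp only [hT]
    rw [Finset.sum_range_succ', Finset.mul_sum]
    simp [pow_succ']
  have hmono : ∀ k, T k ≤ T (k + 1) := fun k => by
    simp only [hT]
    rw [Finset.sum_range_succ _ (k + 1), Submodule.add_eq_sup]
    exact le_sup_left
  have hN : Module.finrank K (Matrix ι ι K) = Fintype.card ι ^ 2 := by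
    rw [Module.finrank_matrix, Module.finrank_self, mul_one, sq]
  have hTJ : T (J - 1) = ⊤ := by
    refine eq_top_iff.2 ?_
    simp only [hT]
    rw [Finset.sum_range_succ, Submodule.add_eq_sup, Nat.sub_add_cancel hJ0, hJ]
    exact le_sup_right
  set r := Module.finrank K S
  have hcount := min_add_le_of_stall (d := fun k => Module.finrank K (T k))
    (N := Fintype.card ι ^ 2) (J := J - 1) (fun k => Submodule.finrank_mono (hmono k))
    (fun k hk => by
      have h1 := Submodule.eq_of_le_of_finrank_le (hmono k) hk.le
      have h2 : T (k + 1 + 1) = T (k + 1) := by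
        rw [hsucc (k + 1), ← h1, ← hsucc k, h1]
      change Module.finrank K (T (k + 1 + 1)) = Module.finrank K (T (k + 1))
      rw [h2])
    (by rw [hTJ, finrank_top, hN])
    (Fintype.card ι ^ 2 - r)
  have h0 : T 0 = S := by simp [hT]
  have hrN : r ≤ Fintype.card ι ^ 2 := hN ▸ Submodule.finrank_le S
  have htop : T (Fintype.card ι ^ 2 - r) = ⊤ := by
    refine Submodule.eq_top_of_finrank_eq (le_antisymm (Submodule.finrank_le _) ?_)
    rw [hN]
    rw [h0] at hcount
    omega
  by_contra! hcon
  have hle : T (Fintype.card ι ^ 2 - r) ≤ LinearMap.ker (traceLinearMap ι K K) := by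
    refine Finset.sum_induction _ (· ≤ LinearMap.ker (traceLinearMap ι K K))
      (fun a b ha hb => sup_le ha hb) bot_le fun i hi A hA => ?_
    rw [Finset.mem_range] at hi
    exact (isNilpotent_trace_of_isNilpotent (hcon (i + 1) (by omega) (by omega) A hA)).eq_zero
  obtain ⟨i⟩ := ‹Nonempty ι›
  have : single i i (1 : K) ∈ LinearMap.ker (traceLinearMap ι K K) := hle (htop ▸ trivial)
  simp at this

/-! ### Transitive spaces of matrices -/

open Matrix in
theorem rank_mul_lt_of_mulVec_eq_zero {K ι : Type*} [Field K] [Fintype ι] [DecidableEq ι]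
    {M T : Matrix ι ι K} {y : ι → K} (hTy : T *ᵥ y ≠ 0) (hMTy : M *ᵥ (T *ᵥ y) = 0) :
    (M * T).rank < T.rank := by
  have hlt : LinearMap.ker T.mulVecLin < LinearMap.ker (M * T).mulVecLin := by
    refine SetLike.lt_iff_le_and_exists.2 ⟨fun x hx => ?_, y, ?_, fun hy => hTy hy⟩
    · rw [LinearMap.mem_ker, mulVecLin_apply] at hx ⊢
      rw [← mulVec_mulVec, hx, mulVec_zero]
    · rw [LinearMap.mem_ker, mulVecLin_apply, ← mulVec_mulVec, hMTy]
  have h1 := LinearMap.finrank_range_add_finrank_ker T.mulVecLin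
  have h2 := LinearMap.finrank_range_add_finrank_ker (M * T).mulVecLin
  have h3 := Submodule.finrank_lt_finrank_of_lt hlt
  unfold rank
  omega

open Matrix in
/-- The rank reduction step. If `B x` is the whole space for every nonzero vector `x` and
`T` has rank at least two, the matrices `T * S * T` with `S ∈ B` form a space of dimension at least
two of maps into the range of `T`, so over an algebraically closed field one of them is
nonzero and has smaller rank than `T`. -/
theorem exists_mul_mul_rank_lt {K ι : Type*} [Field K] [IsAlgClosed K] [Fintype ι]
    [DecidableEq ι] {B : Submodule K (Matrix ι ι K)}
    (hB : ∀ x : ι → K, x ≠ 0 → ∀ y, ∃ W ∈ B, W *ᵥ x = y) {T : Matrix ι ι K} (hT : 1 < T.rank) :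
    ∃ S ∈ B, T * S * T ≠ 0 ∧ (T * S * T).rank < T.rank := by
  set R := LinearMap.range T.mulVecLin
  have hT0 : T ≠ 0 := by
    rintro rfl
    simp at hT
  obtain ⟨x, hx⟩ : ∃ x, T *ᵥ x ≠ 0 := by
    by_contra! h
    exact hT0 (ext_of_mulVec_single fun i => (h _).trans (zero_mulVec _).symm)
  obtain ⟨z, hz⟩ : ∃ z, ∀ c : K, T *ᵥ z ≠ c • (T *ᵥ x) := by
    by_contra! h
    refine hT.not_ge (finrank_le_one_iff.2 ⟨⟨T *ᵥ x, x, rfl⟩, ?_⟩)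
    rintro ⟨_, z, rfl⟩
    obtain ⟨c, hc⟩ := h z
    exact ⟨c, Subtype.ext hc.symm⟩
  -- `T * S₁ * T` and `T * S₂ * T` send `x` to the independent vectors `T x` and `T z`, so no
  -- nontrivial combination of them vanishes.
  obtain ⟨S₁, hS₁, h₁⟩ := hB _ hx x
  obtain ⟨S₂, hS₂, h₂⟩ := hB _ hx z
  -- `φ S` is the restriction of `T * S` to an endomorphism of the range of `T`.
  let φ (S : Matrix ι ι K) : R →ₗ[K] R :=
    (T.mulVecLin.rangeRestrict ∘ₗ S.mulVecLin) ∘ₗ R.subtype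
  have hφ (S : Matrix ι ι K) (w : R) : (φ S w : ι → K) = T *ᵥ (S *ᵥ w) := rfl
  by_cases hinj : Function.Injective (φ S₁)
  -- An eigenvalue `μ` of `(φ S₁)⁻¹ ∘ φ S₂` makes `φ S₂ - μ • φ S₁` singular.
  · let e := LinearEquiv.ofInjectiveEndo (φ S₁) hinj
    have : Nontrivial R := ⟨⟨⟨T *ᵥ x, x, rfl⟩, 0, fun h => hx (congrArg Subtype.val h)⟩⟩
    obtain ⟨μ, hμ⟩ := Module.End.exists_eigenvalue (e.symm.toLinearMap ∘ₗ φ S₂)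
    obtain ⟨w, hw⟩ := hμ.exists_hasEigenvector
    have hw0 := hw.2
    have hw1 : e.symm (φ S₂ w) = μ • w := hw.apply_eq_smul
    have hw2 : φ S₂ w = μ • φ S₁ w := by
      rw [LinearEquiv.symm_apply_eq, map_smul] at hw1
      exact hw1
    obtain ⟨⟨_, y, rfl⟩, hy⟩ : ∃ w' : R, w' = w := ⟨w, rfl⟩
    refine ⟨S₂ - μ • S₁, B.sub_mem hS₂ (B.smul_mem _ hS₁), fun h => hz μ ?_, ?_⟩
    · have : (T * (S₂ - μ • S₁) * T) *ᵥ x = 0 := by rw [h, zero_mulVec]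
      rwa [← mulVec_mulVec, ← mulVec_mulVec, sub_mulVec, smul_mulVec, h₁, h₂, mulVec_sub,
        mulVec_smul, sub_eq_zero] at this
    · refine rank_mul_lt_of_mulVec_eq_zero (y := y) (fun h => hw0 ?_) ?_
      · rw [← hy]
        exact Subtype.ext h
      · have := congrArg Subtype.val hw2
        rw [← hy] at this
        rw [← mulVec_mulVec, sub_mulVec, smul_mulVec, mulVec_sub, mulVec_smul, sub_eq_zero]
        exact this
  · obtain ⟨w, hw, hw0⟩ : ∃ w, φ S₁ w = 0 ∧ w ≠ 0 := by
      by_contra! h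
      exact hinj ((injective_iff_map_eq_zero _).2 h)
    refine ⟨S₁, hS₁, fun h => hx ?_, ?_⟩
    · have : (T * S₁ * T) *ᵥ x = 0 := by rw [h, zero_mulVec]
      rwa [← mulVec_mulVec, ← mulVec_mulVec, h₁] at this
    · obtain ⟨⟨_, y, rfl⟩, hy⟩ : ∃ w' : R, w' = w := ⟨w, rfl⟩
      refine rank_mul_lt_of_mulVec_eq_zero (y := y) (fun h => hw0 ?_) ?_
      · rw [← hy]
        exact Subtype.ext h
      · have := congrArg Subtype.val hw
        rw [← hy] at this
        rw [← mulVec_mulVec]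
        exact this

open Matrix in
theorem exists_vecMulVec_mem_pow {K ι : Type*} [Field K] [IsAlgClosed K] [Fintype ι]
    [DecidableEq ι] {B : Submodule K (Matrix ι ι K)}
    (hB : ∀ x : ι → K, x ≠ 0 → ∀ y, ∃ W ∈ B, W *ᵥ x = y) {k : ℕ} {T : Matrix ι ι K}
    (hTk : T ∈ B ^ k) (hT0 : T ≠ 0) :
    ∃ k, ∃ u v : ι → K, u ≠ 0 ∧ v ≠ 0 ∧ vecMulVec u v ∈ B ^ k := by
  induction hr : T.rank using Nat.strong_induction_on generalizing k T with
  | _ r ih =>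
    by_cases hT : 1 < T.rank
    · obtain ⟨S, hS, h0, hlt⟩ := exists_mul_mul_rank_lt hB hT
      refine ih _ (hr ▸ hlt) (k := k + 1 + k) ?_ h0 rfl
      rw [pow_add, pow_succ]
      exact Submodule.mul_mem_mul (Submodule.mul_mem_mul hTk hS) hTk
    · obtain ⟨⟨u, hu⟩, huc⟩ := finrank_le_one_iff.1 (not_lt.1 hT)
      choose v hv using fun j => huc ⟨T *ᵥ Pi.single j 1, Pi.single j 1, rfl⟩
      have hTuv : T = vecMulVec u v := by
        ext i j
        have := congrFun (congrArg Subtype.val (hv j)) i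
        rw [vecMulVec_apply, mul_comm]
        simpa using this.symm
      refine ⟨k, u, v, ?_, ?_, hTuv ▸ hTk⟩
      · rintro rfl
        exact hT0 (by simp [hTuv])
      · rintro rfl
        exact hT0 (by simp [hTuv])

open Matrix in
/-- Over an algebraically closed field, a space `B` of matrices such that `B x` is the whole space
for every nonzero vector `x` has a power equal to the full matrix algebra: some power contains a
rank-one matrix `T`, and the products `W₁ * T * W₂` with `W₁, W₂ ∈ B` give every rank-one matrix. -/
theorem exists_pow_eq_top_of_transitive {K ι : Type*} [Field K] [IsAlgClosed K] [Fintype ι]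
    [DecidableEq ι] [Nonempty ι] {B : Submodule K (Matrix ι ι K)}
    (hB : ∀ x : ι → K, x ≠ 0 → ∀ y, ∃ W ∈ B, W *ᵥ x = y) : ∃ J, 0 < J ∧ B ^ J = ⊤ := by
  obtain ⟨k, u, v, hu, hv, huv⟩ := exists_vecMulVec_mem_pow hB (k := 0) (T := 1)
    (by rw [pow_zero]; exact Submodule.one_le.1 le_rfl) one_ne_zero
  have hrow : B.map ((vecMulBilin K K) v) = ⊤ := by
    by_contra h
    obtain ⟨f, hf0, hf⟩ := Submodule.exists_le_ker_of_lt_top _ (lt_top_iff_ne_top.2 h)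
    obtain ⟨x, rfl⟩ := (dotProductEquiv K ι).surjective f
    have hx : x ≠ 0 := by
      rintro rfl
      exact hf0 (map_zero _)
    refine hv (dotProduct_eq_zero v fun y => ?_)
    obtain ⟨W, hW, rfl⟩ := hB x hx y
    have : x ⬝ᵥ (v ᵥ* W) = 0 := hf ⟨W, hW, rfl⟩
    rw [dotProduct_mulVec, dotProduct_comm, this]
  refine ⟨1 + k + 1, by omega, eq_top_of_forall_vecMulVec_mem fun y w => ?_⟩
  obtain ⟨W₁, hW₁, rfl⟩ := hB u hu y
  obtain ⟨W₂, hW₂, rfl⟩ : w ∈ B.map ((vecMulBilin K K) v) := hrow ▸ trivial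
  change vecMulVec _ (v ᵥ* W₂) ∈ _
  rw [← vecMulVec_mul, ← mul_vecMulVec, pow_succ, pow_add, pow_one]
  exact Submodule.mul_mem_mul (Submodule.mul_mem_mul hW₁ huv) hW₂

/-! ### Completely positive maps and spans of Kraus products -/

theorem productSpan_eq_pow {n m : ℕ} (V : Fin m → Matrix (Fin n) (Fin n) ℂ) (k : ℕ) :
    productSpan V k = Submodule.span ℂ (Set.range V) ^ k := by
  rw [Submodule.span_pow, productSpan]
  congr 1
  ext X
  rw [Set.mem_pow, Set.mem_range]
  constructor
  · rintro ⟨i, rfl⟩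
    exact ⟨fun j => ⟨V (i j), i j, rfl⟩, rfl⟩
  · rintro ⟨f, rfl⟩
    choose i hi using fun j => (f j).2
    exact ⟨i, by simp only [hi]⟩

theorem cpMap_posSemidef {n m : ℕ} (V : Fin m → Matrix (Fin n) (Fin n) ℂ) {X : Herm n}
    (hX : (X : Matrix (Fin n) (Fin n) ℂ).PosSemidef) :
    (cpMap V X : Matrix (Fin n) (Fin n) ℂ).PosSemidef :=
  Matrix.posSemidef_sum _ fun i _ => hX.mul_mul_conjTranspose_same (V i)

theorem cpMap_pow_posSemidef {n m : ℕ} (V : Fin m → Matrix (Fin n) (Fin n) ℂ) (p : ℕ) {X : Herm n}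
    (hX : (X : Matrix (Fin n) (Fin n) ℂ).PosSemidef) :
    ((cpMap V ^ p) X : Matrix (Fin n) (Fin n) ℂ).PosSemidef := by
  induction p with
  | zero => exact hX
  | succ p ih =>
    rw [pow_succ', Module.End.mul_apply]
    exact cpMap_posSemidef V ih

open Matrix in
theorem cpMap_mulVec_eq_zero_iff {n m : ℕ} (V : Fin m → Matrix (Fin n) (Fin n) ℂ) {X : Herm n}
    (hX : (X : Matrix (Fin n) (Fin n) ℂ).PosSemidef) (y : Fin n → ℂ) :
    (cpMap V X : Matrix (Fin n) (Fin n) ℂ) *ᵥ y = 0 ↔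
      ∀ i, (X : Matrix (Fin n) (Fin n) ℂ) *ᵥ ((V i)ᴴ *ᵥ y) = 0 := by
  have hterm (i) : star y ⬝ᵥ ((V i * X.1 * (V i)ᴴ) *ᵥ y) =
      star ((V i)ᴴ *ᵥ y) ⬝ᵥ ((X : Matrix (Fin n) (Fin n) ℂ) *ᵥ ((V i)ᴴ *ᵥ y)) := by
    rw [← mulVec_mulVec, ← mulVec_mulVec, dotProduct_mulVec, star_mulVec,
      conjTranspose_conjTranspose]
  have hsum : star y ⬝ᵥ ((cpMap V X : Matrix (Fin n) (Fin n) ℂ) *ᵥ y) =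
      ∑ i, star ((V i)ᴴ *ᵥ y) ⬝ᵥ ((X : Matrix (Fin n) (Fin n) ℂ) *ᵥ ((V i)ᴴ *ᵥ y)) := by
    change star y ⬝ᵥ ((∑ i, V i * X.1 * (V i)ᴴ) *ᵥ y) = _
    rw [sum_mulVec, dotProduct_sum]
    exact Finset.sum_congr rfl fun i _ => hterm i
  rw [← (cpMap_posSemidef V hX).dotProduct_mulVec_zero_iff, hsum,
    Finset.sum_eq_zero_iff_of_nonneg fun i _ => hX.dotProduct_mulVec_nonneg _]
  simp only [Finset.mem_univ, true_imp_iff, hX.dotProduct_mulVec_zero_iff]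

open Matrix in
/-- The kernel of `Ψ ^ p X`, for `X` positive semidefinite, in terms of the span of the products of
`p` Kraus operators. -/
theorem cpMap_pow_mulVec_eq_zero_iff {n m : ℕ} (V : Fin m → Matrix (Fin n) (Fin n) ℂ) (p : ℕ)
    {X : Herm n} (hX : (X : Matrix (Fin n) (Fin n) ℂ).PosSemidef) (y : Fin n → ℂ) :
    ((cpMap V ^ p) X : Matrix (Fin n) (Fin n) ℂ) *ᵥ y = 0 ↔
      ∀ W ∈ Submodule.span ℂ (Set.range V) ^ p,
        (X : Matrix (Fin n) (Fin n) ℂ) *ᵥ (Wᴴ *ᵥ y) = 0 := by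
  induction p generalizing y with
  | zero =>
    constructor
    · intro h W hW
      obtain ⟨c, rfl⟩ := Submodule.mem_one.1 hW
      have h : (X : Matrix (Fin n) (Fin n) ℂ) *ᵥ y = 0 := h
      rw [Algebra.algebraMap_eq_smul_one, conjTranspose_smul, conjTranspose_one, smul_mulVec,
        one_mulVec, mulVec_smul, h, smul_zero]
    · intro h
      simpa using h 1 (Submodule.one_le.1 le_rfl)
  | succ p ih =>
    rw [pow_succ', Module.End.mul_apply, cpMap_mulVec_eq_zero_iff V (cpMap_pow_posSemidef V p hX)]
    simp only [ih]
    rw [pow_succ']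
    constructor
    · intro h W hW
      induction hW using Submodule.mul_induction_on' with
      | mem_mul_mem A hA C hC =>
        induction hA using Submodule.span_induction with
        | mem A hA =>
          obtain ⟨i, rfl⟩ := hA
          rw [conjTranspose_mul, ← mulVec_mulVec]
          exact h i C hC
        | zero => simp
        | add A A' _ _ h₁ h₂ =>
          rw [add_mul, conjTranspose_add, add_mulVec, mulVec_add, h₁, h₂, add_zero]
        | smul c A _ h₁ =>
          rw [smul_mul_assoc, conjTranspose_smul, smul_mulVec, mulVec_smul, h₁, smul_zero]
      | add A _ C _ h₁ h₂ =>
        rw [conjTranspose_add, add_mulVec, mulVec_add, h₁, h₂, add_zero]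
    · intro h i W hW
      have := h (V i * W) (Submodule.mul_mem_mul (Submodule.subset_span ⟨i, rfl⟩) hW)
      rwa [conjTranspose_mul, ← mulVec_mulVec] at this

open Matrix in
theorem isStrictlyPositiveMap_cpMap_pow_of_pow_eq_top {n m : ℕ}
    (V : Fin m → Matrix (Fin n) (Fin n) ℂ) {q : ℕ}
    (hq : Submodule.span ℂ (Set.range V) ^ q = ⊤) : IsStrictlyPositiveMap (cpMap V ^ q) := by
  intro X hX hX0
  have hpsd := cpMap_pow_posSemidef V q hX
  refine PosDef.of_dotProduct_mulVec_pos hpsd.isHermitian fun y hy =>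
    lt_of_le_of_ne (hpsd.dotProduct_mulVec_nonneg y) fun h0 => hX0 ?_
  rw [eq_comm, hpsd.dotProduct_mulVec_zero_iff, cpMap_pow_mulVec_eq_zero_iff V q hX, hq] at h0
  obtain ⟨i, hi⟩ := Function.ne_iff.1 hy
  have hi : y i ≠ 0 := hi
  refine Subtype.ext (ext_of_mulVec_single fun j => ?_)
  have := h0 (vecMulVec (Pi.single j 1) (Pi.single i (y i)⁻¹))ᴴ trivial
  rw [conjTranspose_conjTranspose, vecMulVec_mulVec] at this
  refine Eq.trans ?_ (this.trans (zero_mulVec _).symm)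
  simp [hi]

open Matrix in
/-- If `Ψ ^ p` is strictly positive, then no `y ≠ 0` is orthogonal to `W x` for all products `W` of
`p` Kraus operators, as the quadratic form of `Ψ ^ p (x x*)` at `y` is positive. -/
theorem exists_mulVec_eq_of_isStrictlyPositiveMap {n m : ℕ}
    (V : Fin m → Matrix (Fin n) (Fin n) ℂ) {p : ℕ} (hp : IsStrictlyPositiveMap (cpMap V ^ p))
    {x : Fin n → ℂ} (hx : x ≠ 0) (y : Fin n → ℂ) :
    ∃ W ∈ Submodule.span ℂ (Set.range V) ^ p, W *ᵥ x = y := by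
  set B := Submodule.span ℂ (Set.range V) ^ p
  suffices htop : B.map ((mulVecBilin ℂ ℂ).flip x) = ⊤ by
    exact (htop ▸ trivial : y ∈ B.map ((mulVecBilin ℂ ℂ).flip x))
  by_contra h
  obtain ⟨f, hf0, hf⟩ := Submodule.exists_le_ker_of_lt_top _ (lt_top_iff_ne_top.2 h)
  obtain ⟨z, rfl⟩ := (dotProductEquiv ℂ (Fin n)).surjective f
  have hz : star z ≠ 0 := by
    intro hz
    rw [star_eq_zero.1 hz] at hf0
    exact hf0 (map_zero _)
  have hpsd := posSemidef_vecMulVec_self_star x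
  let X : Herm n := ⟨vecMulVec x (star x), hpsd.isHermitian⟩
  have hX0 : X ≠ 0 := by
    intro h0
    obtain ⟨i, hi⟩ := Function.ne_iff.1 hx
    have : x i * star (x i) = 0 := congrFun (congrFun (congrArg Subtype.val h0) i) i
    simp at this
    exact hi this
  have hpos := (hp X hpsd hX0).dotProduct_mulVec_pos hz
  refine hpos.ne' ?_
  rw [(cpMap_pow_mulVec_eq_zero_iff V p (X := X) hpsd (star z)).2, dotProduct_zero]
  intro W hW
  have hWz : z ⬝ᵥ (W *ᵥ x) = 0 := hf ⟨W, hW, rfl⟩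
  have : star x ⬝ᵥ (Wᴴ *ᵥ star z) = 0 := by
    rw [dotProduct_mulVec, ← star_mulVec, star_dotProduct_star, hWz, star_zero]
  change vecMulVec x (star x) *ᵥ _ = 0
  rw [vecMulVec_mulVec, this, MulOpposite.op_zero, zero_smul]

theorem mainTheorem6 (n m : ℕ) (hn : 0 < n) (V : Fin m → Matrix (Fin n) (Fin n) ℂ)
    (hirr : IsIrreducibleMap (cpMap V)) :
    IsPrimitiveMap (cpMap V) ↔
      ∃ q : ℕ, 1 ≤ q ∧
        q ≤ (n ^ 2 - Module.finrank ℂ (Submodule.span ℂ (Set.range V)) + 1) * n ^ 2 ∧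
        productSpan V q = ⊤ := by
  have : Nonempty (Fin n) := ⟨⟨0, hn⟩⟩
  constructor
  · rintro ⟨p, hp0, hp⟩
    obtain ⟨j, hj0, hj⟩ := exists_pow_eq_top_of_transitive fun x hx y =>
      exists_mulVec_eq_of_isStrictlyPositiveMap V hp hx y
    rw [← pow_mul] at hj
    have hJ0 : 0 < p * j := Nat.mul_pos hp0 hj0
    obtain ⟨k, hk1, hk, A, hA, hnil⟩ := exists_not_isNilpotent_mem_pow hJ0 hj
    have hJk : (Submodule.span ℂ (Set.range V) ^ k) ^ (p * j) = ⊤ := by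
      rw [← pow_mul]
      exact pow_eq_top_of_le hJ0 hj (Nat.le_mul_of_pos_left _ hk1)
    have hfull := pow_card_sq_eq_top hJk hA hnil
    rw [Fintype.card_fin] at hk hfull
    refine ⟨k * n ^ 2, Nat.mul_pos hk1 (pow_pos hn 2), Nat.mul_le_mul_right _ hk, ?_⟩
    rw [productSpan_eq_pow, pow_mul, hfull]
  · rintro ⟨q, hq1, -, hq⟩
    rw [productSpan_eq_pow] at hq
    exact ⟨q, hq1, isStrictlyPositiveMap_cpMap_pow_of_pow_eq_top V hq⟩
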